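/- Let $G$ be a (topologically) finitely generated profinite group. For $n\ge 1$ let $c_n(G)$ be the number of open subgroups of $G$ of index $n$ that are intersections of maximal subgroups of $G$ (maximal subgroups are open maximal subgroups, and $G$ itself counts as the empty intersection). Say that $c_n(G)$ is polynomially bounded if there is a constant $\beta$, independent of $n$, such that $c_n(G)\le n^{\beta}$ for all $n\ge 1$ (in particular, every $c_n(G)$ is finite). (1) If $G$ is prosolvable (that is, $G/N$ is solvable for every open normal subgroup $N$ of $G$) and the derived subgroup of $G$ (the closure of the subgroup generated by all commutators) is pronilpotent (that is, all its quotients by its open normal subgroups are nilpotent), then $c_n(G)$ is polynomially bounded. (2) In particular, if $G$ is prosupersolvable (that is, for every open normal subgroup $N$ of $G$ the group $G/N$ has a finite series of normal subgroups of $G/N$, from $1$ to $G/N$, with cyclic factors), then $c_n(G)$ is polynomially bounded. -/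

import Mathlib

/-- A topological group is topologically finitely generated if some finite subset generates
a dense subgroup. -/
def IsTopologicallyFG (G : Type*) [Group G] [TopologicalSpace G] [IsTopologicalGroup G] : Prop :=
  ∃ s : Finset G, (Subgroup.closure (s : Set G)).topologicalClosure = ⊤

/-- A finite series `1 = s 0 ≤ s 1 ≤ ⋯ ≤ s k = G` of normal subgroups of `G` with cyclic
factors exists. -/
def IsSupersolvable (G : Type*) [Group G] : Prop :=
  ∃ (k : ℕ) (s : ℕ → Subgroup G) (_ : ∀ i, (s i).Normal),
    s 0 = ⊥ ∧ s k = ⊤ ∧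
      ∀ i < k, s i ≤ s (i + 1) ∧ IsCyclic (s (i + 1) ⧸ (s i).subgroupOf (s (i + 1)))

/-- A prosolvable group: a profinite (compact, totally disconnected) group all of whose
quotients by open normal subgroups are (finite) solvable. -/
structure IsProsolvable (G : Type*) [Group G] [TopologicalSpace G] [IsTopologicalGroup G] :
    Prop where
  compactSpace : CompactSpace G
  totallyDisconnectedSpace : TotallyDisconnectedSpace G
  isSolvable_quotient : ∀ N : OpenNormalSubgroup G, Group.IsSolvable (G ⧸ N.toSubgroup)

/-- A pronilpotent group: a profinite group all of whose quotients by open normal subgroups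
are (finite) nilpotent. -/
structure IsPronilpotent (G : Type*) [Group G] [TopologicalSpace G] [IsTopologicalGroup G] :
    Prop where
  compactSpace : CompactSpace G
  totallyDisconnectedSpace : TotallyDisconnectedSpace G
  isNilpotent_quotient : ∀ N : OpenNormalSubgroup G, Group.IsNilpotent (G ⧸ N.toSubgroup)

/-- A prosupersolvable group: a profinite group all of whose quotients by open normal subgroups
are (finite) supersolvable. -/
structure IsProsupersolvable (G : Type*) [Group G] [TopologicalSpace G] [IsTopologicalGroup G] :
    Prop where
  compactSpace : CompactSpace G
  totallyDisconnectedSpace : TotallyDisconnectedSpace G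
  isSupersolvable_quotient : ∀ N : OpenNormalSubgroup G, IsSupersolvable (G ⧸ N.toSubgroup)

/-- The derived subgroup of a topological group: the closure of the abstract commutator
subgroup. -/
abbrev closedDerivedSubgroup (G : Type*) [Group G] [TopologicalSpace G] [IsTopologicalGroup G] :
    Subgroup G :=
  (commutator G).topologicalClosure

/-- `H` is an intersection of (open) maximal subgroups of `G`. The empty intersection is `G`. -/
def IsMaximalIntersection {G : Type*} [Group G] [TopologicalSpace G] (H : Subgroup G) : Prop :=
  ∃ S : Set (Subgroup G), (∀ M ∈ S, IsOpen (M : Set G) ∧ IsCoatom M) ∧ H = sInf S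

/-- `c_n(G)`, the number of open subgroups of index `n` in `G` that are intersections of maximal
subgroups; a priori this is an extended natural number. -/
noncomputable def maximalIntersectionCount (G : Type*) [Group G] [TopologicalSpace G] (n : ℕ) :
    ℕ∞ :=
  {H : Subgroup G | IsOpen (H : Set G) ∧ H.index = n ∧ IsMaximalIntersection H}.encard

/-- `c_n(G)` is polynomially bounded: for some `β`, one has `c_n(G) ≤ n ^ β` for all `n ≥ 1`
(in particular each `c_n(G)` is finite). -/
def HasPolynomialMaximalIntersectionGrowth (G : Type*) [Group G] [TopologicalSpace G] : Prop :=
  ∃ β : ℕ, ∀ n : ℕ, 1 ≤ n → maximalIntersectionCount G n ≤ (n : ℕ∞) ^ β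

/-! Everything happens in finite quotients: finitely many open subgroups of finite index contain a
common open normal subgroup, so a bound for finite `d`-generated groups with nilpotent derived
subgroup, with exponent depending only on `d`, is enough. The supersolvable case falls under this,
since there the derived subgroup centralizes every cyclic factor of the series
(`IsSupersolvable.isNilpotent_commutator`).

Let A be the derived subgroup of such a finite G. A maximal subgroup contains [A, A] when A is
nilpotent (`IsCoatom.commutator_le_of_isNilpotent`), so A may be taken abelian. An intersection H of
maximal subgroups is then counted through the pair K = HA, N = H ∩ A, where |G : H| = |G : K| |A :
N|. There are polynomially many K because they correspond to subgroups of a quotient of ℤ^d, and at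
most |A : N|^d subgroups H over a given pair (`ncard_sup_eq_inf_eq_le`).

The main point is the count of N, an intersection of maximal G-submodules of A. G acts on A by
commuting operators, so a maximal submodule of index q is the kernel of a map to the field with q
elements on which G acts by a character. The character is fixed by its values on the d generators
and the map by its values on their commutators, giving at most q^(d + d²) submodules
(`ncard_isMaxNormalIn_le`). Passing to intersections costs only 2 in the exponent, because the sum
of 1/q² over q ≥ 2 is at most 1 (`ncard_isMaxNormalInter_le`). -/

open scoped commutatorElement

/-! ### Maximal submodules for commuting operators, and characters -/

/-- A maximal submodule over a commutative ring of finite index is the kernel of a semilinear map to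
any field of the right cardinality. -/
theorem exists_semilinear_ker_eq {R V : Type*} [CommRing R] [AddCommGroup V] [Module R V]
    {M : Submodule R V} (hM : IsCoatom M) (hfin : Nat.card (V ⧸ M) ≠ 0) :
    IsPrimePow (Nat.card (V ⧸ M)) ∧ ∀ (F : Type) [Field F] [Finite F],
      Nat.card (V ⧸ M) = Nat.card F → ∃ (φ : R →+* F) (f : V →+ F),
        (∀ r v, f (r • v) = φ r * f v) ∧ ∀ v, f v = 0 ↔ v ∈ M := by
  obtain ⟨I, hI, ⟨e⟩⟩ := isSimpleModule_iff_quot_maximal.1 (isSimpleModule_iff_isCoatom.2 hM)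
  let : Field (R ⧸ I) := Ideal.Quotient.field I
  rw [Nat.card_congr e.toEquiv] at hfin ⊢
  have : Finite (R ⧸ I) := Nat.finite_of_card_ne_zero hfin
  let := Fintype.ofFinite (R ⧸ I)
  refine ⟨by rw [Nat.card_eq_fintype_card]; exact Fintype.isPrimePow_card_of_field,
    fun F _ _ hc => ?_⟩
  let := Fintype.ofFinite F
  let σ : (R ⧸ I) ≃+* F := FiniteField.ringEquivOfCardEq (by simpa using hc)
  refine ⟨(σ : (R ⧸ I) →+* F).comp (Ideal.Quotient.mk I),
    (σ : (R ⧸ I) →+ F).comp ((e : V ⧸ M →+ R ⧸ I).comp (M.mkQ : V →+ V ⧸ M)), ?_, ?_⟩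
  · intro r v
    have h1 : e (M.mkQ (r • v)) = Ideal.Quotient.mk I r * e (M.mkQ v) := by
      rw [map_smul, map_smul, Algebra.smul_def]
      rfl
    change σ (e (M.mkQ (r • v))) = σ (Ideal.Quotient.mk I r) * σ (e (M.mkQ v))
    rw [h1, map_mul]
  · intro v
    change σ (e (M.mkQ v)) = 0 ↔ v ∈ M
    rw [map_eq_zero_iff σ σ.injective, map_eq_zero_iff e e.injective, Submodule.mkQ_apply,
      Submodule.Quotient.mk_eq_zero]

theorem exists_character_ker_eq_of_commRing {R G V : Type*} [CommRing R] [Group G]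
    [AddCommGroup V] [Module R V] (ρ : G →* R)
    (hR : ∀ L : AddSubgroup V, (∀ g, ∀ v ∈ L, ρ g • v ∈ L) → ∀ r : R, ∀ v ∈ L, r • v ∈ L)
    (N : AddSubgroup V) (hN : ∀ g, ∀ v ∈ N, ρ g • v ∈ N) (hne : N ≠ ⊤)
    (hmax : ∀ L : AddSubgroup V, (∀ g, ∀ v ∈ L, ρ g • v ∈ L) → N < L → L = ⊤)
    (hfin : N.index ≠ 0) :
    IsPrimePow N.index ∧ ∀ (F : Type) [Field F] [Finite F], N.index = Nat.card F →
      ∃ (χ : G →* F) (f : V →+ F), (∀ g v, f (ρ g • v) = χ g * f v) ∧ ∀ v, f v = 0 ↔ v ∈ N := by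
  obtain ⟨M, hMN⟩ : ∃ M : Submodule R V, M.toAddSubgroup = N :=
    ⟨{ N with smul_mem' := fun r v hv => hR N hN r v hv }, rfl⟩
  have hM : IsCoatom M := by
    refine ⟨fun h => hne (by rw [← hMN, h]; rfl), fun L hL => ?_⟩
    rw [← Submodule.toAddSubgroup_inj]
    refine hmax _ (fun g v hv => L.smul_mem (ρ g) hv) ?_
    rw [← hMN]
    exact Submodule.toAddSubgroup_strictMono hL
  have hc : N.index = Nat.card (V ⧸ M) := by rw [← hMN]; rfl
  obtain ⟨hq, hF⟩ := exists_semilinear_ker_eq hM (hc ▸ hfin)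
  refine ⟨hc ▸ hq, fun F _ _ hcard => ?_⟩
  obtain ⟨φ, f, hf, hker⟩ := hF F (hc ▸ hcard)
  refine ⟨(φ : R →* F).comp ρ, f, fun g v => hf (ρ g) v, fun v => ?_⟩
  rw [hker, ← hMN]
  rfl

/-- Let commuting endomorphisms of an abelian group `V` be given by an action of `G`. A maximal
invariant subgroup of `V` of finite index is the kernel of an equivariant map to any field of the right
cardinality, on which `G` acts through a multiplicative character. -/
theorem exists_character_ker_eq {G V : Type*} [Group G] [AddCommGroup V]
    (ρ : G →* Module.End ℤ V) (hρ : ∀ g h, ρ g * ρ h = ρ h * ρ g)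
    (N : AddSubgroup V) (hN : ∀ g, ∀ v ∈ N, ρ g v ∈ N) (hne : N ≠ ⊤)
    (hmax : ∀ L : AddSubgroup V, (∀ g, ∀ v ∈ L, ρ g v ∈ L) → N < L → L = ⊤)
    (hfin : N.index ≠ 0) :
    IsPrimePow N.index ∧ ∀ (F : Type) [Field F] [Finite F], N.index = Nat.card F →
      ∃ (χ : G →* F) (f : V →+ F), (∀ g v, f (ρ g v) = χ g * f v) ∧ ∀ v, f v = 0 ↔ v ∈ N := by
  -- The operators generate a commutative ring, whose submodules are exactly the invariant
  -- subgroups.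
  have hcomm : IsMulCommutative (Subring.closure (Set.range ρ)) :=
    Subring.isMulCommutative_closure (by rintro _ ⟨g, rfl⟩ _ ⟨h, rfl⟩; exact hρ g h)
  have hsmul : ∀ L : AddSubgroup V, (∀ g, ∀ v ∈ L, ρ g v ∈ L) →
      ∀ r ∈ Subring.closure (Set.range ρ), ∀ v ∈ L, r v ∈ L := by
    intro L hL r hr
    induction hr using Subring.closure_induction with
    | mem x hx => obtain ⟨g, rfl⟩ := hx; exact hL g
    | zero => intro v _; simp
    | one => intro v hv; simpa using hv
    | add x y _ _ hx hy => intro v hv; simpa using L.add_mem (hx v hv) (hy v hv)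
    | neg x _ hx => intro v hv; simpa using hx v hv
    | mul x y _ _ hx hy => intro v hv; simpa using hx _ (hy v hv)
  let instR : CommRing (Subring.closure (Set.range ρ)) :=
    { (inferInstance : Ring (Subring.closure (Set.range ρ))) with
      mul_comm := hcomm.is_comm.comm }
  exact exists_character_ker_eq_of_commRing (R := Subring.closure (Set.range ρ)) (G := G)
    ((ρ.codRestrict (Subring.closure (Set.range ρ)) fun g => Subring.subset_closure ⟨g, rfl⟩ :))
    (fun L hL r v hv => hsmul L hL r.1 r.2 v hv) N hN hne hmax hfin

/-- `N` is maximal among the normal subgroups of `G` properly contained in `A`. -/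
structure IsMaxNormalIn {G : Type*} [Group G] (A N : Subgroup G) : Prop where
  normal : N.Normal
  lt : N < A
  eq_of_lt : ∀ L : Subgroup G, L.Normal → N < L → L ≤ A → L = A

/-- Conjugation makes A a module on which A itself acts trivially; as G/A is abelian, the operators
commute, and normal subgroups inside A are the invariant subgroups. -/
theorem IsMaxNormalIn.exists_character {G : Type*} [Group G] {A N : Subgroup G} [A.Normal]
    (hAc : ∀ a ∈ A, ∀ b ∈ A, a * b = b * a) (hA : commutator G ≤ A) (hN : IsMaxNormalIn A N)
    (hfin : N.relIndex A ≠ 0) :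
    IsPrimePow (N.relIndex A) ∧ ∀ (F : Type) [Field F] [Finite F], N.relIndex A = Nat.card F →
      ∃ (χ : G →* F) (f : A →* Multiplicative F),
        (∀ g a, (f (MulAut.conjNormal g a)).toAdd = χ g * (f a).toAdd) ∧
          ∀ a : A, f a = 1 ↔ (a : G) ∈ N := by
  let : CommGroup A :=
    { (inferInstance : Group A) with
      mul_comm := fun a b => Subtype.ext (hAc a a.2 b b.2) }
  let ρ : G →* Module.End ℤ (Additive A) :=
    { toFun := fun g => (MonoidHom.toAdditive (MulAut.conjNormal g : A ≃* A).toMonoidHom).toIntLinearMap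
      map_one' := by ext; simp
      map_mul' := fun g h => by ext; simp }
  have hcomm : ∀ g h, ρ g * ρ h = ρ h * ρ g := by
    intro g h
    refine LinearMap.ext fun a => Additive.toMul.injective (Subtype.ext ?_)
    change g * (h * a.toMul * h⁻¹) * g⁻¹ = h * (g * a.toMul * g⁻¹) * h⁻¹
    have h1 := hAc _ (hA (Subgroup.commutator_mem_commutator (Subgroup.mem_top g⁻¹)
      (Subgroup.mem_top h⁻¹))) _ a.toMul.2
    rw [commutatorElement_def] at h1
    calc g * (h * a.toMul * h⁻¹) * g⁻¹
        = h * g * ((g⁻¹ * h⁻¹ * g⁻¹⁻¹ * h⁻¹⁻¹) * a.toMul) * (h⁻¹ * g⁻¹) := by group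
      _ = _ := by rw [h1]; group
  let N' : AddSubgroup (Additive A) := Subgroup.toAddSubgroup (N.subgroupOf A)
  have key : ∀ L : AddSubgroup (Additive A), (∀ g, ∀ v ∈ L, ρ g v ∈ L) →
      ((AddSubgroup.toSubgroup' L).map A.subtype).Normal := by
    intro L hL
    refine ⟨?_⟩
    rintro _ ⟨a, ha, rfl⟩ g
    exact ⟨MulAut.conjNormal g a, hL g _ ha, rfl⟩
  have hinv : ∀ g, ∀ v ∈ N', ρ g v ∈ N' := fun g v hv => hN.normal.conj_mem _ hv g
  have hne : N' ≠ ⊤ := by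
    intro h
    refine hN.lt.not_ge fun a ha => ?_
    have : Additive.ofMul ⟨a, ha⟩ ∈ N' := by rw [h]; trivial
    exact this
  have hmax : ∀ L : AddSubgroup (Additive A), (∀ g, ∀ v ∈ L, ρ g v ∈ L) → N' < L → L = ⊤ := by
    intro L hL hlt
    have h1 : (AddSubgroup.toSubgroup' L).map A.subtype = A := by
      refine hN.eq_of_lt _ (key L hL) ?_ (Subgroup.map_subtype_le _)
      refine lt_of_le_of_ne (fun n hn => ⟨⟨n, hN.lt.le hn⟩, hlt.le hn, rfl⟩)
        fun h => hlt.not_ge fun v hv => ?_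
      have : ((v.toMul : A) : G) ∈ N := by rw [h]; exact ⟨v.toMul, hv, rfl⟩
      exact this
    refine (AddSubgroup.eq_top_iff' L).2 fun v => ?_
    have h2 : ((v.toMul : A) : G) ∈ (AddSubgroup.toSubgroup' L).map A.subtype := by
      rw [h1]; exact v.toMul.2
    obtain ⟨w, hw, hwv⟩ := h2
    exact (show Additive.ofMul w = v from Subtype.ext hwv) ▸ hw
  obtain ⟨hq, hF⟩ := exists_character_ker_eq ρ hcomm N' hinv hne hmax hfin
  refine ⟨hq, fun F _ _ hcard => ?_⟩
  obtain ⟨χ, f, hf, hker⟩ := hF F hcard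
  exact ⟨χ, ⟨⟨fun a => Multiplicative.ofAdd (f (Additive.ofMul a)), f.map_zero⟩,
    fun a b => f.map_add (Additive.ofMul a) (Additive.ofMul b)⟩,
    fun g a => hf g (Additive.ofMul a), fun a => hker (Additive.ofMul a)⟩

/-! ### Counting maximal submodules of the derived subgroup -/

/-- If `x` generates `G`, the commutators of the `x i` generate the derived subgroup as a normal
subgroup. -/
theorem commutator_le_of_normal_of_mem {G ι : Type*} [Group G] {x : ι → G}
    (hx : Subgroup.closure (Set.range x) = ⊤) (L : Subgroup G) [L.Normal]
    (hL : ∀ i j, ⁅x i, x j⁆ ∈ L) : commutator G ≤ L := by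
  rw [← Subgroup.Normal.quotient_commutative_iff_commutator_le]
  have h1 : Subgroup.closure (Set.range fun i => (x i : G ⧸ L)) = ⊤ := by
    have := MonoidHom.map_closure (QuotientGroup.mk' L) (Set.range x)
    rw [hx, ← MonoidHom.range_eq_map, MonoidHom.range_eq_top.2 (QuotientGroup.mk'_surjective L),
      ← Set.range_comp] at this
    exact this.symm
  have h2 : IsMulCommutative (Subgroup.closure (Set.range fun i => (x i : G ⧸ L))) := by
    refine Subgroup.isMulCommutative_closure ?_
    rintro _ ⟨i, rfl⟩ _ ⟨j, rfl⟩
    rw [← commutatorElement_eq_one_iff_mul_comm]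
    exact (QuotientGroup.eq_one_iff _).2 (hL i j)
  refine ⟨⟨fun a b => ?_⟩⟩
  have h3 := h2.is_comm.comm ⟨a, by rw [h1]; trivial⟩ ⟨b, by rw [h1]; trivial⟩
  exact congrArg Subtype.val h3

/-- In a `d`-generated metabelian group, the number of subgroups of index `q` in the derived
subgroup that are maximal among the normal subgroups is at most `q ^ (d + d * d)`. -/
theorem ncard_isMaxNormalIn_le {G : Type*} [Group G] {d : ℕ} {x : Fin d → G}
    (hx : Subgroup.closure (Set.range x) = ⊤)
    (hAc : ∀ a ∈ commutator G, ∀ b ∈ commutator G, a * b = b * a) {q : ℕ} (hq : q ≠ 0) :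
    {N : Subgroup G | IsMaxNormalIn (commutator G) N ∧ N.relIndex (commutator G) = q}.ncard ≤
      q ^ (d + d * d) := by
  set S := {N : Subgroup G | IsMaxNormalIn (commutator G) N ∧ N.relIndex (commutator G) = q}
  by_cases hS : S = ∅
  · simp [hS]
  obtain ⟨N₀, hN₀, hN₀q⟩ := Set.nonempty_iff_ne_empty.2 hS
  have hpp : IsPrimePow q := hN₀q ▸ (hN₀.exists_character hAc le_rfl (hN₀q ▸ hq)).1
  obtain ⟨F, _, _, hFq⟩ : ∃ (F : Type) (_ : Field F) (_ : Finite F), Nat.card F = q := by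
    obtain ⟨instF⟩ : Nonempty (Field (Fin q)) := by
      rw [Fintype.nonempty_field_iff]; simpa using hpp
    exact ⟨Fin q, instF, inferInstance, by simp⟩
  have hex : ∀ N : S, ∃ (χ : G →* F) (f : commutator G →* Multiplicative F),
        (∀ g a, (f (MulAut.conjNormal g a)).toAdd = χ g * (f a).toAdd) ∧
          ∀ a : commutator G, f a = 1 ↔ (a : G) ∈ N.1 := fun N =>
    (N.2.1.exists_character hAc le_rfl (N.2.2 ▸ hq)).2 F (by rw [N.2.2, hFq])
  choose χ f hf hker using hex
  have hmem : ∀ i j, ⁅x i, x j⁆ ∈ commutator G := fun i j =>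
    Subgroup.commutator_mem_commutator (Subgroup.mem_top _) (Subgroup.mem_top _)
  let Φ : S → (Fin d → F) × (Fin d × Fin d → F) := fun N =>
    (fun i => χ N (x i), fun ij => (f N ⟨⁅x ij.1, x ij.2⁆, hmem _ _⟩).toAdd)
  have hΦ : Function.Injective Φ := by
    intro N M h
    have hχ : χ N = χ M := MonoidHom.eq_of_eqOn_dense hx (by
      rintro _ ⟨i, rfl⟩
      exact congrFun (congrArg Prod.fst h) i)
    -- Since the characters agree, the locus where the two maps agree is normal in G; it contains
    -- the commutators of the generators, hence is the whole derived subgroup.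
    let E := ((f N).eqLocus (f M)).map (commutator G).subtype
    have hE : E.Normal := by
      refine ⟨?_⟩
      rintro _ ⟨a, ha, rfl⟩ g
      refine ⟨MulAut.conjNormal g a, ?_, rfl⟩
      change f N _ = f M _
      apply Multiplicative.toAdd.injective
      rw [hf, hf, hχ, (ha : f N a = f M a)]
    have hle : commutator G ≤ E := commutator_le_of_normal_of_mem hx E fun i j =>
      ⟨⟨⁅x i, x j⁆, hmem i j⟩, congrFun (congrArg Prod.snd h) (i, j), rfl⟩
    have hfe : ∀ a, f N a = f M a := by
      intro a
      obtain ⟨b, hb, hba⟩ := hle a.2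
      rw [← Subtype.ext hba]
      exact hb
    refine Subtype.ext (Subgroup.ext fun a => ⟨fun ha => ?_, fun ha => ?_⟩)
    · exact (hker M ⟨a, N.2.1.lt.le ha⟩).1 (hfe _ ▸ (hker N ⟨a, N.2.1.lt.le ha⟩).2 ha)
    · exact (hker N ⟨a, M.2.1.lt.le ha⟩).1 (hfe _ ▸ (hker M ⟨a, M.2.1.lt.le ha⟩).2 ha)
  have := Nat.card_le_card_of_injective Φ hΦ
  rw [← Nat.card_coe_set_eq]
  simpa [pow_add, hFq, Nat.card_fun] using this

/-! ### Counting intersections of maximal submodules -/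

theorem ncard_image2_le {α β γ : Type*} [Finite α] [Finite β] (f : α → β → γ) (s : Set α)
    (t : Set β) : (Set.image2 f s t).ncard ≤ s.ncard * t.ncard := by
  rw [← Set.image_uncurry_prod, ← Set.ncard_prod]
  exact Set.ncard_image_le (Set.toFinite _)

/-- Irredundant intersections of maximal elements among the normal subgroups of `G` properly
contained in `A`, including `A` itself. -/
inductive IsMaxNormalInter {G : Type*} [Group G] (A : Subgroup G) : Subgroup G → Prop
  | self : IsMaxNormalInter A A
  | inf {N M : Subgroup G} : IsMaxNormalInter A N → IsMaxNormalIn A M → N ⊔ M = A →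
      IsMaxNormalInter A (N ⊓ M)

namespace IsMaxNormalInter

variable {G : Type*} [Group G] {A : Subgroup G}

theorem le {N : Subgroup G} (hN : IsMaxNormalInter A N) : N ≤ A := by
  induction hN with
  | self => exact le_rfl
  | inf _ _ _ ih => exact inf_le_left.trans ih

theorem normal [hA : A.Normal] {N : Subgroup G} (hN : IsMaxNormalInter A N) : N.Normal := by
  induction hN with
  | self => exact hA
  | inf _ hM _ ih =>
    have := ih
    have := hM.normal
    exact Subgroup.normal_inf_normal _ _

/-- This is where redundant terms disappear: either N ≤ M and intersecting changes nothing, or NM is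
normal and strictly above M, hence equal to A. -/
theorem inf_of_isMaxNormalIn [A.Normal] {N M : Subgroup G} (hN : IsMaxNormalInter A N)
    (hM : IsMaxNormalIn A M) : IsMaxNormalInter A (N ⊓ M) := by
  by_cases h : N ≤ M
  · rwa [inf_eq_left.2 h]
  · have := hN.normal
    have := hM.normal
    exact hN.inf hM (hM.eq_of_lt _ (Subgroup.sup_normal N M)
      (lt_of_le_of_ne le_sup_right fun h' => h (h' ▸ le_sup_left))
      (sup_le hN.le hM.lt.le))

theorem of_finite [A.Normal] {T : Set (Subgroup G)} (hT : T.Finite)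
    (h : ∀ M ∈ T, IsMaxNormalIn A M) : IsMaxNormalInter A (A ⊓ sInf T) := by
  induction T, hT using Set.Finite.induction_on with
  | empty => simpa using self
  | @insert M T _ _ ih =>
    have := (ih fun N hN => h N (Set.mem_insert_of_mem _ hN)).inf_of_isMaxNormalIn
      (h M (Set.mem_insert _ _))
    rwa [sInf_insert, inf_comm M, ← inf_assoc]

theorem relIndex_inf {N M : Subgroup G} [M.Normal] (h : N ⊔ M = A) :
    (N ⊓ M).relIndex A = N.relIndex A * M.relIndex A := by
  rw [← Subgroup.relIndex_mul_relIndex (N ⊓ M) N A inf_le_left (h ▸ le_sup_left),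
    Subgroup.inf_relIndex_left, ← Subgroup.relIndex_sup_right, h, mul_comm]

end IsMaxNormalInter

/-- Each term is at most m^(c+2)/q², and the sum of 1/q² for 1 < q ≤ m telescopes to at most 1. This
is why the exponent grows by 2. -/
theorem sum_pow_mul_div_pow_le (c m : ℕ) (hm : 1 ≤ m) :
    ∑ q ∈ Finset.Ioc 1 m, q ^ c * (m / q) ^ (c + 2) ≤ m ^ (c + 2) := by
  have h1 : ∀ q ∈ Finset.Ioc 1 m, ((q ^ c * (m / q) ^ (c + 2) : ℕ) : ℝ) ≤
      (m : ℝ) ^ (c + 2) * ((q : ℝ) ^ 2)⁻¹ := by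
    intro q hq
    have hq0 : (0 : ℝ) < q := by
      have := (Finset.mem_Ioc.1 hq).1
      exact_mod_cast (by omega : 0 < q)
    push_cast
    calc
      (q : ℝ) ^ c * ((m / q : ℕ) : ℝ) ^ (c + 2) ≤ (q : ℝ) ^ c * ((m : ℝ) / q) ^ (c + 2) := by
          gcongr
          exact Nat.cast_div_le
      _ = _ := by rw [div_pow, pow_add (q : ℝ)]; field_simp
  have h2 := sum_Ioc_inv_sq_le_sub (α := ℝ) one_ne_zero hm
  have h3 : ((∑ q ∈ Finset.Ioc 1 m, q ^ c * (m / q) ^ (c + 2) : ℕ) : ℝ) ≤ ((m ^ (c + 2) : ℕ) : ℝ) := by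
    rw [Nat.cast_sum]
    refine (Finset.sum_le_sum h1).trans ?_
    rw [← Finset.mul_sum, Nat.cast_pow]
    refine mul_le_of_le_one_right (by positivity) (h2.trans ?_)
    simp
  exact_mod_cast h3

/-- If the number of maximal normal subgroups in `A` of index `q` is at most `q ^ c`, the number
of their intersections of index `m` is at most `m ^ (c + 2)`. -/
theorem ncard_isMaxNormalInter_le {G : Type*} [Group G] [Finite G] {A : Subgroup G} {c : ℕ}
    (hc : ∀ q, q ≠ 0 → {N : Subgroup G | IsMaxNormalIn A N ∧ N.relIndex A = q}.ncard ≤ q ^ c)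
    (m : ℕ) (hm : m ≠ 0) :
    {N : Subgroup G | IsMaxNormalInter A N ∧ N.relIndex A = m}.ncard ≤ m ^ (c + 2) := by
  induction m using Nat.strong_induction_on with
  | _ m ih =>
  by_cases hm1 : m = 1
  · subst hm1
    rw [one_pow, Set.ncard_le_one]
    rintro N ⟨hN, hN1⟩ M ⟨hM, hM1⟩
    rw [Subgroup.relIndex_eq_one] at hN1 hM1
    rw [le_antisymm hN.le hN1, le_antisymm hM.le hM1]
  -- Peel off the last maximal term M, of index q > 1: by irredundancy indices multiply, so the
  -- remaining intersection has index m/q.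
  · have hsub : {N : Subgroup G | IsMaxNormalInter A N ∧ N.relIndex A = m} ⊆
        ⋃ q ∈ Finset.Ioc 1 m, Set.image2 (fun M N => N ⊓ M)
          {N : Subgroup G | IsMaxNormalIn A N ∧ N.relIndex A = q}
          {N : Subgroup G | IsMaxNormalInter A N ∧ N.relIndex A = m / q} := by
      rintro N ⟨hN, hNm⟩
      cases hN with
      | self => exact absurd (by rw [← hNm, Subgroup.relIndex_self]) hm1
      | @inf N M hN hM h =>
        have := hM.normal
        rw [IsMaxNormalInter.relIndex_inf h] at hNm
        have hM0 : M.relIndex A ≠ 0 := fun h0 => hm (by rw [← hNm, h0, mul_zero])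
        have hM1 : M.relIndex A ≠ 1 := fun h1 => hM.lt.not_ge (Subgroup.relIndex_eq_one.1 h1)
        refine Set.mem_biUnion (x := M.relIndex A) ?_ ⟨M, ⟨hM, rfl⟩, N, ⟨hN, ?_⟩, rfl⟩
        · exact Finset.mem_coe.2 (Finset.mem_Ioc.2
            ⟨by omega, Nat.le_of_dvd (by omega) ⟨N.relIndex A, by rw [← hNm, mul_comm]⟩⟩)
        · rw [← hNm, Nat.mul_div_cancel _ (by omega)]
    refine (Set.ncard_le_ncard hsub).trans ((Finset.set_ncard_biUnion_le _ _).trans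
      ((Finset.sum_le_sum fun q hq => ?_).trans (sum_pow_mul_div_pow_le c m (by omega))))
    rw [Finset.mem_Ioc] at hq
    refine (ncard_image2_le _ _ _).trans (Nat.mul_le_mul (hc q (by omega)) ?_)
    exact ih _ (Nat.div_lt_self (by omega) hq.1) (Nat.div_pos hq.2 (by omega)).ne'

/-! ### Subgroups of ℤ^d and subgroups containing the derived subgroup -/

theorem exists_closure_range_eq_of_pi_int {d : ℕ} (L : AddSubgroup (Fin d → ℤ)) :
    ∃ k : Fin d → Fin d → ℤ, AddSubgroup.closure (Set.range k) = L := by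
  obtain ⟨n, ⟨b⟩⟩ := Submodule.nonempty_basis_of_pid (Pi.basisFun ℤ (Fin d)) L.toIntSubmodule
  have hn : n ≤ d := by
    have := Submodule.finrank_le L.toIntSubmodule
    rwa [Module.finrank_eq_card_basis b, Fintype.card_fin, Module.finrank_fin_fun] at this
  -- A basis may have fewer than d elements; the list is padded with zeros.
  refine ⟨fun i => if h : (i : ℕ) < n then (b ⟨i, h⟩ : Fin d → ℤ) else 0, le_antisymm ?_ ?_⟩
  · rw [AddSubgroup.closure_le]
    rintro _ ⟨i, rfl⟩
    dsimp only
    split_ifs with h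
    · exact (b ⟨i, h⟩).2
    · exact L.zero_mem
  · intro v hv
    have h1 := congrArg Subtype.val (b.sum_repr ⟨v, hv⟩)
    change _ = v at h1
    rw [← h1, AddSubmonoidClass.coe_finsetSum]
    refine AddSubgroup.sum_mem _ fun i _ => ?_
    refine AddSubgroup.zsmul_mem _ (AddSubgroup.subset_closure (Set.mem_range.2 ⟨Fin.castLE hn i, ?_⟩)) _
    simp

theorem ncard_addSubgroup_pi_int_index_eq_le (d : ℕ) {m : ℕ} (hm : m ≠ 0) :
    {L : AddSubgroup (Fin d → ℤ) | L.index = m}.Finite ∧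
      {L : AddSubgroup (Fin d → ℤ) | L.index = m}.ncard ≤ m ^ (d * d) := by
  choose k hk using exists_closure_range_eq_of_pi_int (d := d)
  have : NeZero m := ⟨hm⟩
  let Φ : {L : AddSubgroup (Fin d → ℤ) | L.index = m} → Fin d → Fin d → ZMod m :=
    fun L i j => (k L i j : ZMod m)
  have hle : ∀ L M : {L : AddSubgroup (Fin d → ℤ) | L.index = m}, Φ L = Φ M → L.1 ≤ M.1 := by
    intro L M h
    rw [← hk L.1, AddSubgroup.closure_le]
    rintro _ ⟨i, rfl⟩
    -- A subgroup of index m contains mℤ^d, so it is determined by its d generators modulo m, that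
    -- is, by d² residues.
    have h1 : ∃ w : Fin d → ℤ, k L i - k M i = m • w := by
      have h2 : ∀ j, ∃ c : ℤ, k L i j - k M i j = m * c := fun j =>
        (ZMod.intCast_eq_intCast_iff_dvd_sub _ _ _).1 (congrFun (congrFun h.symm i) j)
      choose w hw using h2
      exact ⟨w, funext fun j => by simpa using hw j⟩
    obtain ⟨w, hw⟩ := h1
    have h3 : m • w ∈ M.1 := by
      have := M.1.nsmul_index_mem w
      rwa [M.2] at this
    have h4 : k M i ∈ M.1 := by
      have : k M i ∈ AddSubgroup.closure (Set.range (k M)) := AddSubgroup.subset_closure ⟨i, rfl⟩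
      rwa [hk] at this
    have := M.1.add_mem h3 h4
    rwa [← hw, sub_add_cancel] at this
  have hΦ : Function.Injective Φ := fun L M h =>
    Subtype.ext (le_antisymm (hle L M h) (hle M L h.symm))
  refine ⟨Set.finite_coe_iff.1 (Finite.of_injective Φ hΦ), ?_⟩
  have := Nat.card_le_card_of_injective Φ hΦ
  rw [← Nat.card_coe_set_eq]
  simpa [Nat.card_fun, pow_mul] using this

theorem Abelianization.exists_surjective_pi_int {G : Type*} [Group G] {d : ℕ} {x : Fin d → G}
    (hx : Subgroup.closure (Set.range x) = ⊤) :
    ∃ f : (Fin d → ℤ) →+ Additive (Abelianization G), Function.Surjective f := by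
  let y : Fin d → Additive (Abelianization G) := fun i => Additive.ofMul (Abelianization.of (x i))
  refine ⟨(Fintype.linearCombination ℤ y).toAddMonoidHom, ?_⟩
  have h1 : ∀ g : G, ∃ v, Fintype.linearCombination ℤ y v = Additive.ofMul (Abelianization.of g) := by
    intro g
    have hg : g ∈ Subgroup.closure (Set.range x) := by rw [hx]; trivial
    induction hg using Subgroup.closure_induction with
    | mem g hg =>
      obtain ⟨i, rfl⟩ := hg
      exact ⟨Pi.single i 1, by simp [y, Fintype.linearCombination_apply_single]⟩
    | one => exact ⟨0, by simp⟩
    | mul a b _ _ ha hb =>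
      obtain ⟨v, hv⟩ := ha
      obtain ⟨w, hw⟩ := hb
      exact ⟨v + w, by rw [map_add, hv, hw, map_mul, ofMul_mul]⟩
    | inv a _ ha =>
      obtain ⟨v, hv⟩ := ha
      exact ⟨-v, by rw [map_neg, hv, map_inv, ofMul_inv]⟩
  intro b
  obtain ⟨g, hg⟩ := QuotientGroup.mk_surjective b.toMul
  obtain ⟨v, hv⟩ := h1 g
  exact ⟨v, hv.trans (congrArg Additive.ofMul hg)⟩

/-- In a `d`-generated group, a subgroup containing the derived subgroup is generated by `d`
elements modulo it. -/
theorem exists_commutator_sup_closure_eq {G : Type*} [Group G] {d : ℕ} {x : Fin d → G}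
    (hx : Subgroup.closure (Set.range x) = ⊤) {K : Subgroup G} (hK : commutator G ≤ K) :
    ∃ k : Fin d → G, Subgroup.closure (Set.range k) ⊔ commutator G = K := by
  obtain ⟨f, hf⟩ := Abelianization.exists_surjective_pi_int hx
  obtain ⟨v, hv⟩ := exists_closure_range_eq_of_pi_int
    ((Subgroup.toAddSubgroup (K.map Abelianization.of)).comap f)
  have hsurj : Function.Surjective (Abelianization.of : G →* Abelianization G) :=
    QuotientGroup.mk_surjective
  choose k hk using fun i => hsurj (f (v i)).toMul
  have h1 := congrArg (AddSubgroup.map f) hv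
  rw [AddSubgroup.map_comap_eq_self_of_surjective hf, AddMonoidHom.map_closure, ← Set.range_comp]
    at h1
  have h2 : (Subgroup.closure (Set.range k)).map Abelianization.of = K.map Abelianization.of := by
    apply Subgroup.toAddSubgroup.injective
    rw [← h1, MonoidHom.map_closure, Subgroup.toAddSubgroup_closure, ← Set.range_comp]
    congr 1
    ext b
    constructor
    · rintro ⟨i, hi⟩
      exact ⟨i, Additive.toMul.injective ((hk i).symm.trans hi)⟩
    · rintro ⟨i, hi⟩
      exact ⟨i, by rw [← hi] ; exact hk i⟩
  have h3 := congrArg (Subgroup.comap Abelianization.of) h2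
  rw [Subgroup.comap_map_eq, Subgroup.comap_map_eq, Abelianization.ker_of, sup_eq_left.2 hK] at h3
  exact ⟨k, h3⟩

theorem ncard_commutator_le_index_eq_le {G : Type*} [Group G] {d : ℕ} {x : Fin d → G}
    (hx : Subgroup.closure (Set.range x) = ⊤) {m : ℕ} (hm : m ≠ 0) :
    {K : Subgroup G | commutator G ≤ K ∧ K.index = m}.ncard ≤ m ^ (d * d) := by
  obtain ⟨f, hf⟩ := Abelianization.exists_surjective_pi_int hx
  have hsurj : Function.Surjective (Abelianization.of : G →* Abelianization G) :=
    QuotientGroup.mk_surjective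
  refine (Set.ncard_le_ncard_of_injOn
    (fun K : Subgroup G => (Subgroup.toAddSubgroup (K.map Abelianization.of)).comap f) ?_ ?_
    (ncard_addSubgroup_pi_int_index_eq_le d hm).1).trans
    (ncard_addSubgroup_pi_int_index_eq_le d hm).2
  · rintro K ⟨hK, hKm⟩
    change AddSubgroup.index _ = m
    rw [AddSubgroup.index_comap_of_surjective _ hf, ← hKm,
      ← Subgroup.index_map_eq K hsurj (by rwa [Abelianization.ker_of])]
    rfl
  · rintro K ⟨hK, -⟩ M ⟨hM, -⟩ h
    have h1 := Subgroup.toAddSubgroup.injective (AddSubgroup.comap_injective hf h)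
    have h3 := congrArg (Subgroup.comap Abelianization.of) h1
    rwa [Subgroup.comap_map_eq, Subgroup.comap_map_eq, Abelianization.ker_of, sup_eq_left.2 hK,
      sup_eq_left.2 hM] at h3

/-! ### Finite groups with abelian derived subgroup -/

theorem ncard_biUnion_le_mul {α ι : Type*} {s : Set ι} (hs : s.Finite) (t : ι → Set α) (b : ℕ)
    (h : ∀ i ∈ s, (t i).ncard ≤ b) : (⋃ i ∈ s, t i).ncard ≤ s.ncard * b := by
  lift s to Finset ι using hs
  rw [Set.ncard_coe_finset, ← smul_eq_mul]
  exact (Finset.set_ncard_biUnion_le s t).trans (Finset.sum_le_card_nsmul s _ b h)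

theorem relIndex_sup_eq_relIndex_inf {G : Type*} [Group G] [Finite G] (H A : Subgroup G)
    [A.Normal] : H.relIndex (H ⊔ A) = (H ⊓ A).relIndex A := by
  have h1 := Subgroup.relIndex_mul_relIndex (H ⊓ A) H (H ⊔ A) inf_le_left le_sup_left
  rw [← Subgroup.relIndex_mul_relIndex (H ⊓ A) A (H ⊔ A) inf_le_right le_sup_right,
    Subgroup.relIndex_sup_right, Subgroup.inf_relIndex_left, mul_comm] at h1
  exact Nat.eq_of_mul_eq_mul_right
    (Nat.pos_of_ne_zero (A.subgroupOf H).index_ne_zero_of_finite) h1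

section Coatom

variable {G : Type*} [Group G] {A M : Subgroup G}

/-- L is not inside M, so G = ML; writing a ∈ A as ml puts m in M ∩ A, which lies in L. -/
theorem IsCoatom.eq_of_inf_lt (hM : IsCoatom M) {L : Subgroup G} (hL : L.Normal)
    (hlt : M ⊓ A < L) (hLA : L ≤ A) : L = A := by
  refine le_antisymm hLA fun a ha => ?_
  have hLM : ¬L ≤ M := fun h' => hlt.not_ge (le_inf h' hLA)
  have hg : a ∈ M ⊔ L := by
    rw [hM.2 _ (left_lt_sup.2 hLM)]; trivial
  obtain ⟨m, hm, l, hl, rfl⟩ := Subgroup.mem_sup_of_normal_right.1 hg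
  have hmA : m ∈ A := by simpa using A.mul_mem ha (A.inv_mem (hLA hl))
  exact L.mul_mem (hlt.le ⟨hm, hmA⟩) hl

/-- Here G = MA, where M normalizes M ∩ A because A is normal, and A centralizes it because A is
abelian. -/
theorem IsCoatom.isMaxNormalIn_inf [hA : A.Normal] (hAc : ∀ a ∈ A, ∀ b ∈ A, a * b = b * a)
    (hM : IsCoatom M) (h : ¬A ≤ M) : IsMaxNormalIn A (M ⊓ A) where
  normal := by
    refine ⟨fun n hn g => ?_⟩
    have hg : g ∈ M ⊔ A := by
      rw [hM.2 _ (left_lt_sup.2 h)]; trivial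
    obtain ⟨m, hm, a, ha, rfl⟩ := Subgroup.mem_sup_of_normal_right.1 hg
    refine ⟨?_, hA.conj_mem _ hn.2 _⟩
    have h1 : m * a * n * (m * a)⁻¹ = m * n * m⁻¹ := by
      rw [mul_assoc m a n, hAc a ha n hn.2]; group
    rw [h1]
    exact M.mul_mem (M.mul_mem hm hn.1) (M.inv_mem hm)
  lt := lt_of_le_of_ne inf_le_right fun h' => h (inf_eq_right.1 h')
  eq_of_lt := fun _ hL hlt hLA => hM.eq_of_inf_lt hL hlt hLA

theorem isMaxNormalInter_sInf_inf [Finite G] [A.Normal]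
    (hAc : ∀ a ∈ A, ∀ b ∈ A, a * b = b * a) {S : Set (Subgroup G)} (hS : ∀ M ∈ S, IsCoatom M) :
    IsMaxNormalInter A (sInf S ⊓ A) := by
  have h1 : sInf S ⊓ A = A ⊓ sInf ((fun M => M ⊓ A) '' {M | M ∈ S ∧ ¬A ≤ M}) := by
    refine le_antisymm (le_inf inf_le_right (le_sInf ?_)) (le_inf (le_sInf fun M hM => ?_) inf_le_left)
    · rintro _ ⟨M, hM, rfl⟩
      exact inf_le_inf_right A (sInf_le hM.1)
    · by_cases h : A ≤ M
      · exact inf_le_left.trans h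
      · exact inf_le_right.trans
          ((sInf_le (Set.mem_image_of_mem _ (show M ∈ {M | M ∈ S ∧ ¬A ≤ M} from ⟨hM, h⟩))).trans
            inf_le_left)
  rw [h1]
  refine IsMaxNormalInter.of_finite (Set.toFinite _) ?_
  rintro _ ⟨M, hM, rfl⟩
  exact (hS M hM.1).isMaxNormalIn_inf hAc hM.2

end Coatom

/-- If `K` is generated by `d` elements modulo `A`, there are at most `|A : N| ^ d` subgroups `H`
with `H A = K` and `H ∩ A = N`. -/
theorem ncard_sup_eq_inf_eq_le {G : Type*} [Group G] [Finite G] {d : ℕ} {A K N : Subgroup G}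
    [A.Normal] (k : Fin d → G) (hk : Subgroup.closure (Set.range k) ⊔ A = K)
    (hN : (N.subgroupOf A).Normal) :
    {H : Subgroup G | H ⊔ A = K ∧ H ⊓ A = N}.ncard ≤ N.relIndex A ^ d := by
  set S := {H : Subgroup G | H ⊔ A = K ∧ H ⊓ A = N}
  have hex : ∀ (H : S) (i : Fin d), ∃ a : A, k i * (a : G)⁻¹ ∈ H.1 := by
    intro H i
    have h1 : k i ∈ H.1 ⊔ A := by
      rw [H.2.1, ← hk]
      exact (le_sup_left : _ ≤ _ ⊔ A) (Subgroup.subset_closure ⟨i, rfl⟩)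
    obtain ⟨m, hm, a, ha, hma⟩ := Subgroup.mem_sup_of_normal_right.1 h1
    exact ⟨⟨a, ha⟩, by simpa [← hma] using hm⟩
  choose a ha using hex
  -- H contains some k i * a⁻¹ with a ∈ A, and the coset of a modulo N is recorded. These elements
  -- generate K modulo A, so together with N = H ∩ A they determine H.
  let Φ : S → Fin d → A ⧸ N.subgroupOf A := fun H i => (a H i : A)
  have hle : ∀ H L : S, Φ H = Φ L → H.1 ≤ L.1 := by
    intro H L h y hy
    have h1 : Subgroup.closure (Set.range fun i => k i * (a H i : G)⁻¹) ≤ H.1 ⊓ L.1 := by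
      rw [Subgroup.closure_le]
      rintro _ ⟨i, rfl⟩
      refine ⟨ha H i, ?_⟩
      have h2 : a L i * (a H i)⁻¹ ∈ N.subgroupOf A := by
        have := hN.mem_comm (QuotientGroup.eq.1 (congrFun h i))
        exact this
      have h3 : (a L i : G) * (a H i : G)⁻¹ ∈ L.1 := by
        have h4 : (a L i : G) * (a H i : G)⁻¹ ∈ N := h2
        rw [← L.2.2] at h4
        exact h4.1
      simpa [mul_assoc] using L.1.mul_mem (ha L i) h3
    have h5 : K ≤ Subgroup.closure (Set.range fun i => k i * (a H i : G)⁻¹) ⊔ A := by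
      rw [← hk, sup_le_iff, Subgroup.closure_le]
      refine ⟨?_, le_sup_right⟩
      rintro _ ⟨i, rfl⟩
      have := Subgroup.mul_mem_sup (Subgroup.subset_closure
        (Set.mem_range_self (f := fun i => k i * (a H i : G)⁻¹) i)) (a H i).2
      simpa using this
    have h6 : y ∈ K := H.2.1 ▸ (le_sup_left : H.1 ≤ H.1 ⊔ A) hy
    obtain ⟨c, hc, b, hb, rfl⟩ := Subgroup.mem_sup_of_normal_right.1 (h5 h6)
    have hcm := h1 hc
    have hbH : b ∈ H.1 := by simpa using H.1.mul_mem (H.1.inv_mem hcm.1) hy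
    have hbN : b ∈ H.1 ⊓ A := ⟨hbH, hb⟩
    rw [H.2.2, ← L.2.2] at hbN
    exact L.1.mul_mem hcm.2 hbN.1
  have hΦ : Function.Injective Φ := fun H L h =>
    Subtype.ext (le_antisymm (hle H L h) (hle L H h.symm))
  have := Nat.card_le_card_of_injective Φ hΦ
  rw [← Nat.card_coe_set_eq]
  rw [Nat.card_fun, Nat.card_fin] at this
  exact this

/-- The subgroups of index `n` that are intersections of maximal subgroups. -/
def coatomIntersections (G : Type*) [Group G] (n : ℕ) : Set (Subgroup G) :=
  {H | H.index = n ∧ ∃ S : Set (Subgroup G), (∀ M ∈ S, IsCoatom M) ∧ H = sInf S}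

/-- An exponent bounding the growth of the number of intersections of maximal subgroups in finite
`d`-generated groups with nilpotent derived subgroup. -/
def coatomIntersectionExponent (d : ℕ) : ℕ := (d * d + 1) + ((d + d * d + 2 + 1) + d)

theorem ncard_coatomIntersections_le_of_commute {G : Type*} [Group G] [Finite G] {d : ℕ}
    {x : Fin d → G} (hx : Subgroup.closure (Set.range x) = ⊤)
    (hAc : ∀ a ∈ commutator G, ∀ b ∈ commutator G, a * b = b * a) {n : ℕ} (hn : n ≠ 0) :
    (coatomIntersections G n).ncard ≤ n ^ coatomIntersectionExponent d := by
  set A := commutator G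
  -- Only the bound m ≤ n on the index is kept; summing over m costs one more power of n.
  have hle : ∀ {β : Type _} (P : β → Prop) (ind : β → ℕ) (e : ℕ),
      (∀ m, m ≠ 0 → {b | P b ∧ ind b = m}.ncard ≤ m ^ e) →
      (⋃ m ∈ Finset.Ioc 0 n, {b | P b ∧ ind b = m}).ncard ≤ n ^ (e + 1) := by
    intro β P ind e h
    refine (Finset.set_ncard_biUnion_le _ _).trans ((Finset.sum_le_card_nsmul _ _ (n ^ e)
      fun m hm => ?_).trans_eq (by simp [pow_succ, mul_comm]))
    rw [Finset.mem_Ioc] at hm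
    exact (h m (by omega)).trans (Nat.pow_le_pow_left hm.2 e)
  have hK := hle (fun K : Subgroup G => A ≤ K) Subgroup.index (d * d)
    fun m hm => ncard_commutator_le_index_eq_le hx hm
  have hN := hle (IsMaxNormalInter A) (fun N => N.relIndex A) (d + d * d + 2)
    fun m hm => ncard_isMaxNormalInter_le (fun q hq => ncard_isMaxNormalIn_le hx hAc hq) m hm
  set 𝒦 := ⋃ m ∈ Finset.Ioc 0 n, {K : Subgroup G | A ≤ K ∧ K.index = m} with h𝒦
  set 𝒩 := ⋃ m ∈ Finset.Ioc 0 n, {N : Subgroup G | IsMaxNormalInter A N ∧ N.relIndex A = m} with h𝒩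
  have hsub : coatomIntersections G n ⊆
      ⋃ K ∈ 𝒦, ⋃ N ∈ 𝒩, {H : Subgroup G | H ⊔ A = K ∧ H ⊓ A = N} := by
    rintro H ⟨hHn, S, hS, hHS⟩
    have h1 : (H ⊓ A).relIndex A * (H ⊔ A).index = n := by
      rw [← hHn, ← Subgroup.relIndex_mul_index (le_sup_left : H ≤ H ⊔ A),
        relIndex_sup_eq_relIndex_inf]
    have h2 : (H ⊓ A).relIndex A ≠ 0 := fun h => hn (by rw [← h1, h, zero_mul])
    have h3 : (H ⊔ A).index ≠ 0 := fun h => hn (by rw [← h1, h, mul_zero])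
    simp only [Set.mem_iUnion, h𝒦, h𝒩, Set.mem_ofPred_eq, Finset.mem_Ioc, exists_prop]
    refine ⟨H ⊔ A, ⟨_, ⟨Nat.pos_of_ne_zero h3, ?_⟩, le_sup_right, rfl⟩, H ⊓ A,
      ⟨_, ⟨Nat.pos_of_ne_zero h2, ?_⟩, ?_, rfl⟩, rfl, rfl⟩
    · exact Nat.le_of_dvd (by omega) ⟨_, by rw [← h1, mul_comm]⟩
    · exact Nat.le_of_dvd (by omega) ⟨_, h1.symm⟩
    · rw [hHS]
      exact isMaxNormalInter_sInf_inf hAc hS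
  have hfib : ∀ K ∈ 𝒦, ∀ N ∈ 𝒩, {H : Subgroup G | H ⊔ A = K ∧ H ⊓ A = N}.ncard ≤ n ^ d := by
    intro K hK N hN
    simp only [Set.mem_iUnion, h𝒦, h𝒩, Set.mem_ofPred_eq, Finset.mem_Ioc, exists_prop] at hK hN
    obtain ⟨_, -, hAK, -⟩ := hK
    obtain ⟨_, ⟨-, hm⟩, hNA, rfl⟩ := hN
    obtain ⟨k, hk⟩ := exists_commutator_sup_closure_eq hx hAK
    have := hNA.normal
    exact (ncard_sup_eq_inf_eq_le k hk inferInstance).trans (Nat.pow_le_pow_left hm d)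
  calc (coatomIntersections G n).ncard
      ≤ 𝒦.ncard * (𝒩.ncard * n ^ d) := (Set.ncard_le_ncard hsub).trans
        (ncard_biUnion_le_mul (Set.toFinite _) _ _ fun K hK =>
          ncard_biUnion_le_mul (Set.toFinite _) _ _ fun N hN => hfib K hK N hN)
    -- The factors bound the choices of HA, of H ∩ A, and of H given both.
    _ ≤ n ^ (d * d + 1) * (n ^ (d + d * d + 2 + 1) * n ^ d) := by gcongr
    _ = _ := by rw [coatomIntersectionExponent, ← pow_add, ← pow_add]

/-! ### Nilpotent derived subgroups and supersolvable groups -/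

theorem map_commutator_of_surjective {G Q : Type*} [Group G] [Group Q] {φ : G →* Q}
    (hφ : Function.Surjective φ) : (commutator G).map φ = commutator Q := by
  rw [commutator_def, Subgroup.map_commutator, ← MonoidHom.range_eq_map,
    MonoidHom.range_eq_top.2 hφ, commutator_def]

/-- Otherwise G/N would be a nontrivial solvable group equal to its own derived subgroup. -/
theorem Group.IsNilpotent.eq_top_of_commutator_sup_eq_top {G : Type*} [Group G]
    [Group.IsNilpotent G] (N : Subgroup G) [N.Normal] (h : commutator G ⊔ N = ⊤) : N = ⊤ := by
  by_contra hN
  have : Nontrivial (G ⧸ N) := QuotientGroup.nontrivial_iff.2 hN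
  refine (Group.IsSolvable.commutator_lt_top_of_nontrivial (G ⧸ N)).ne ?_
  have hsurj := QuotientGroup.mk'_surjective N
  have h1 := congrArg (Subgroup.map (QuotientGroup.mk' N)) h
  rwa [Subgroup.map_sup, QuotientGroup.map_mk'_self, sup_bot_eq,
    map_commutator_of_surjective hsurj, ← MonoidHom.range_eq_map,
    MonoidHom.range_eq_top.2 hsurj] at h1

/-- A maximal subgroup contains the derived subgroup of any nilpotent normal
subgroup. -/
theorem IsCoatom.commutator_le_of_isNilpotent {G : Type*} [Group G] {M : Subgroup G}
    (hM : IsCoatom M) (A : Subgroup G) [hA : A.Normal] [Group.IsNilpotent A] : ⁅A, A⁆ ≤ M := by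
  by_cases h : A ≤ M
  · exact (Subgroup.commutator_le_left A A).trans h
  have hlt : M.subgroupOf A < ⊤ := lt_top_iff_ne_top.2 fun h' => h (Subgroup.subgroupOf_eq_top.1 h')
  obtain ⟨a, ha, haM⟩ := SetLike.exists_of_lt (Group.normalizerCondition_of_isNilpotent _ hlt)
  -- M normalizes M ∩ A, and so does the element a of A outside M supplied by the normalizer
  -- condition; maximality of M does the rest.
  have hnorm : Subgroup.normalizer ((M ⊓ A : Subgroup G) : Set G) = ⊤ := by
    refine hM.2 _ (lt_of_le_of_ne ?_ fun h' => haM ?_)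
    · exact (le_inf Subgroup.le_normalizer
        ((le_top : M ≤ ⊤).trans_eq (Subgroup.normalizer_eq_top_iff.2 hA).symm)).trans
        (Subgroup.inf_normalizer_le_normalizer_inf)
    · change (a : G) ∈ M
      rw [h', Subgroup.mem_normalizer_iff]
      rw [Subgroup.mem_normalizer_iff] at ha
      intro g
      constructor
      · rintro ⟨hg, hgA⟩
        exact ⟨(ha ⟨g, hgA⟩).1 hg, hA.conj_mem _ hgA _⟩
      · rintro ⟨hg, hgA⟩
        have hgA' : g ∈ A := by simpa [mul_assoc] using hA.conj_mem _ hgA (a : G)⁻¹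
        exact ⟨(ha ⟨g, hgA'⟩).2 hg, hgA'⟩
  have hN : (M ⊓ A).Normal := Subgroup.normalizer_eq_top_iff.1 hnorm
  by_contra hc
  have hlt' : M ⊓ A < ⁅A, A⁆ ⊔ (M ⊓ A) := lt_of_le_of_ne le_sup_right fun h' =>
    hc ((le_sup_left.trans_eq h'.symm).trans inf_le_left)
  -- If [A, A] were not in M, then [A, A](M ∩ A) = A, which in a nilpotent A forces M ∩ A = A.
  have h1 := hM.eq_of_inf_lt (Subgroup.sup_normal _ _) hlt'
    (sup_le (Subgroup.commutator_le_left A A) inf_le_right)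
  have h2 : commutator A ⊔ (M ⊓ A).subgroupOf A = ⊤ := by
    apply Subgroup.map_injective A.subtype_injective
    rw [Subgroup.map_sup, commutator_def, Subgroup.map_commutator, ← MonoidHom.range_eq_map,
      Subgroup.range_subtype, Subgroup.map_subgroupOf_eq_of_le inf_le_right, h1]
  have h3 := Group.IsNilpotent.eq_top_of_commutator_sup_eq_top _ h2
  exact h ((Subgroup.subgroupOf_eq_top.1 h3).trans inf_le_left)

/-- Conjugations act on the powers of t as power maps, which commute, so commutators act trivially.
-/
theorem commutator_le_centralizer_of_conj_eq_zpow {G : Type*} [Group G] (t : G)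
    (h : ∀ g : G, ∃ z : ℤ, g * t * g⁻¹ = t ^ z) : commutator G ≤ Subgroup.centralizer {t} := by
  have key : ∀ g k : G, g * (k * t * k⁻¹) * g⁻¹ = k * (g * t * g⁻¹) * k⁻¹ := by
    intro g k
    obtain ⟨a, ha⟩ := h g
    obtain ⟨b, hb⟩ := h k
    rw [ha, hb, ← conj_zpow, ← conj_zpow, ha, hb, ← zpow_mul, ← zpow_mul, mul_comm]
  rw [commutator_def, Subgroup.commutator_le]
  intro g _ k _
  rw [Subgroup.mem_centralizer_singleton_iff, ← mul_inv_eq_iff_eq_mul, commutatorElement_def]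
  calc g * k * g⁻¹ * k⁻¹ * t * (g * k * g⁻¹ * k⁻¹)⁻¹
      = g * k * (g⁻¹ * (k⁻¹ * t * k⁻¹⁻¹) * g⁻¹⁻¹) * (g * k)⁻¹ := by group
    _ = t := by rw [key]; group

/-- The derived subgroup of a supersolvable group is nilpotent. -/
theorem IsSupersolvable.isNilpotent_commutator {G : Type*} [Group G] (h : IsSupersolvable G) :
    Group.IsNilpotent (commutator G) := by
  obtain ⟨k, s, hs, h0, hk, hstep⟩ := h
  rw [Subgroup.nilpotent_iff_finite_ascending_central_series]
  -- Truncating the index at k keeps the series constant once it has reached G.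
  refine ⟨k, fun i => (s (min i k)).subgroupOf (commutator G), ⟨?_, ?_⟩, ?_⟩
  · simp [h0]
  · intro x n hx g
    rcases lt_or_ge n k with hn | hn
    · change (x : G) ∈ s (min (n + 1) k) at hx
      change ((⁅x, g⁆ : commutator G) : G) ∈ s (min n k)
      rw [min_eq_left hn] at hx
      rw [min_eq_left hn.le]
      obtain ⟨hle, hcyc⟩ := hstep n hn
      have := hs n
      obtain ⟨t, ht⟩ := hcyc.exists_generator
      obtain ⟨t, rfl⟩ := QuotientGroup.mk_surjective t
      have hpow : ∀ y ∈ s (n + 1), ∃ z : ℤ, (y : G ⧸ s n) = (t : G) ^ z := by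
        intro y hy
        obtain ⟨z, hz⟩ := Subgroup.mem_zpowers_iff.1 (ht ((⟨y, hy⟩ : s (n + 1)) : _ ⧸ _))
        refine ⟨z, ?_⟩
        rw [← QuotientGroup.mk_zpow] at hz ⊢
        exact (QuotientGroup.eq.2 (show ((t : G) ^ z)⁻¹ * y ∈ s n from by
          simpa [Subgroup.mem_subgroupOf] using QuotientGroup.eq.1 hz)).symm
      have hcent := commutator_le_centralizer_of_conj_eq_zpow (G := G ⧸ s n) ((t : G) : G ⧸ s n)
        fun g => by
          obtain ⟨g, rfl⟩ := QuotientGroup.mk_surjective g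
          exact hpow _ ((hs (n + 1)).conj_mem _ t.2 g)
      have hg : ((g : G) : G ⧸ s n) ∈ commutator (G ⧸ s n) := by
        rw [← map_commutator_of_surjective (QuotientGroup.mk'_surjective (s n))]
        exact ⟨g, g.2, rfl⟩
      obtain ⟨z, hz⟩ := hpow _ hx
      have hcomm : Commute ((x : G) : G ⧸ s n) ((g : G) : G ⧸ s n) := by
        rw [hz]
        have h1 : Commute ((t : G) : G ⧸ s n) ((g : G) : G ⧸ s n) :=
          (Subgroup.mem_centralizer_singleton_iff.1 (hcent hg)).symm
        exact h1.zpow_left z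
      exact (QuotientGroup.eq_one_iff _).1 (commutatorElement_eq_one_iff_commute.2 hcomm)
    · change _ ∈ (s (min n k)).subgroupOf _
      rw [min_eq_right hn, hk]
      trivial
  · simp [hk]

/-! ### Passage to quotients and the profinite case -/

theorem IsCoatom.map_of_ker_le {G Q : Type*} [Group G] [Group Q] {φ : G →* Q}
    (hφ : Function.Surjective φ) {M : Subgroup G} (hM : IsCoatom M) (hker : φ.ker ≤ M) :
    IsCoatom (M.map φ) := by
  have hc : (M.map φ).comap φ = M := by rw [Subgroup.comap_map_eq, sup_eq_left.2 hker]
  refine ⟨fun h => hM.1 (by rw [← hc, h, Subgroup.comap_top]), fun L hL => ?_⟩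
  have h1 : M < L.comap φ := by
    rw [← hc]
    exact (Subgroup.comap_lt_comap_of_surjective hφ).2 hL
  rw [← Subgroup.map_comap_eq_self_of_surjective hφ L, hM.2 _ h1,
    ← MonoidHom.range_eq_map, MonoidHom.range_eq_top.2 hφ]

/-- Transport of intersections of maximal subgroups along a quotient map. -/
theorem map_mem_coatomIntersections {G Q : Type*} [Group G] [Group Q] {φ : G →* Q}
    (hφ : Function.Surjective φ) {S : Set (Subgroup G)} (hS : ∀ M ∈ S, IsCoatom M)
    (hker : ∀ M ∈ S, φ.ker ≤ M) :
    (sInf S).map φ ∈ coatomIntersections Q (sInf S).index := by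
  refine ⟨Subgroup.index_map_eq _ hφ (le_sInf hker), Subgroup.map φ '' S, ?_, ?_⟩
  · rintro _ ⟨M, hM, rfl⟩
    exact (hS M hM).map_of_ker_le hφ (hker M hM)
  · refine le_antisymm (le_sInf ?_) fun q hq => ?_
    · rintro _ ⟨M, hM, rfl⟩
      exact Subgroup.map_mono (sInf_le hM)
    · obtain ⟨g, rfl⟩ := hφ q
      refine Subgroup.mem_map_of_mem φ (Subgroup.mem_sInf.2 fun M hM => ?_)
      have h1 : g ∈ (M.map φ).comap φ := Subgroup.mem_sInf.1 hq _ ⟨M, hM, rfl⟩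
      rwa [Subgroup.comap_map_eq, sup_eq_left.2 (hker M hM)] at h1

theorem map_injOn_ker_le {G Q : Type*} [Group G] [Group Q] (φ : G →* Q) :
    Set.InjOn (Subgroup.map φ) {H | φ.ker ≤ H} := by
  intro H hH L hL h
  have h1 := congrArg (Subgroup.comap φ) h
  rwa [Subgroup.comap_map_eq, Subgroup.comap_map_eq, sup_eq_left.2 hH, sup_eq_left.2 hL] at h1

theorem closure_range_map_eq_top {G Q ι : Type*} [Group G] [Group Q] {φ : G →* Q}
    (hφ : Function.Surjective φ) {x : ι → G} (hx : Subgroup.closure (Set.range x) = ⊤) :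
    Subgroup.closure (Set.range (φ ∘ x)) = ⊤ := by
  rw [Set.range_comp, ← MonoidHom.map_closure, hx, ← MonoidHom.range_eq_map,
    MonoidHom.range_eq_top.2 hφ]

theorem ncard_coatomIntersections_le_of_isNilpotent {G : Type*} [Group G] [Finite G] {d : ℕ}
    {x : Fin d → G} (hx : Subgroup.closure (Set.range x) = ⊤)
    (hnil : Group.IsNilpotent (commutator G)) {n : ℕ} (hn : n ≠ 0) :
    (coatomIntersections G n).ncard ≤ n ^ coatomIntersectionExponent d := by
  let φ := QuotientGroup.mk' ⁅commutator G, commutator G⁆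
  have hφ : Function.Surjective φ := QuotientGroup.mk'_surjective _
  have hφker : φ.ker = ⁅commutator G, commutator G⁆ := QuotientGroup.ker_mk' _
  have hker : ∀ M : Subgroup G, IsCoatom M → φ.ker ≤ M := fun M hM =>
    hφker.trans_le (hM.commutator_le_of_isNilpotent (commutator G))
  refine le_trans (Set.ncard_le_ncard_of_injOn (Subgroup.map φ) ?_
    ((map_injOn_ker_le φ).mono ?_) (Set.toFinite _))
    (ncard_coatomIntersections_le_of_commute (closure_range_map_eq_top hφ hx) ?_ hn)
  · rintro _ ⟨rfl, S, hS, rfl⟩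
    exact map_mem_coatomIntersections hφ hS fun M hM => hker M (hS M hM)
  · rintro _ ⟨-, S, hS, rfl⟩
    exact le_sInf fun M hM => hker M (hS M hM)
  · rw [← map_commutator_of_surjective hφ]
    rintro _ ⟨a, ha, rfl⟩ _ ⟨b, hb, rfl⟩
    rw [← commutatorElement_eq_one_iff_mul_comm, ← map_commutatorElement, ← MonoidHom.mem_ker, hφker]
    exact Subgroup.commutator_mem_commutator ha hb

theorem closure_range_quotient_eq_top {G ι : Type*} [Group G] [TopologicalSpace G]
    [IsTopologicalGroup G] {x : ι → G}
    (hx : (Subgroup.closure (Set.range x)).topologicalClosure = ⊤) (N : OpenNormalSubgroup G) :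
    Subgroup.closure (Set.range (QuotientGroup.mk' N.toSubgroup ∘ x)) = ⊤ := by
  rw [Set.range_comp, ← MonoidHom.map_closure]
  have h1 : Subgroup.closure (Set.range x) ⊔ N.toSubgroup = ⊤ := by
    have hopen : IsOpen ((Subgroup.closure (Set.range x) ⊔ N.toSubgroup : Subgroup G) : Set G) :=
      Subgroup.isOpen_mono le_sup_right N.isOpen'
    rw [eq_top_iff, ← hx]
    exact Subgroup.topologicalClosure_minimal _ le_sup_left (Subgroup.isClosed_of_isOpen _ hopen)
  have h2 := congrArg (Subgroup.map (QuotientGroup.mk' N.toSubgroup)) h1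
  rwa [Subgroup.map_sup, QuotientGroup.map_mk'_self, sup_bot_eq, ← MonoidHom.range_eq_map,
    MonoidHom.range_eq_top.2 (QuotientGroup.mk'_surjective _)] at h2

/-- Finitely many open subgroups of finite index contain a common open normal subgroup. -/
theorem exists_openNormalSubgroup_le {G : Type*} [Group G] [TopologicalSpace G]
    [IsTopologicalGroup G] {Y : Set (Subgroup G)} (hY : Y.Finite)
    (h : ∀ H ∈ Y, IsOpen (H : Set G) ∧ H.index ≠ 0) :
    ∃ N : OpenNormalSubgroup G, ∀ H ∈ Y, N.toSubgroup ≤ H := by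
  have hopen : ∀ H ∈ Y, IsOpen (H.normalCore : Set G) := by
    intro H hH
    have : H.FiniteIndex := ⟨(h H hH).2⟩
    exact Subgroup.isOpen_of_isClosed_of_finiteIndex _
      (H.normalCore_isClosed (Subgroup.isClosed_of_isOpen _ (h H hH).1))
  have hinf : IsOpen ((⨅ H : Y, H.1.normalCore : Subgroup G) : Set G) := by
    rw [Subgroup.coe_iInf, ← Set.biInter_eq_iInter Y fun H _ => (H.normalCore : Set G)]
    exact hY.isOpen_biInter hopen
  exact ⟨⟨⟨⨅ H : Y, H.1.normalCore, hinf⟩,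
    Subgroup.normal_iInf_normal fun H => H.1.normalCore_normal⟩,
    fun H hH => (iInf_le (fun H : Y => H.1.normalCore) ⟨H, hH⟩).trans H.normalCore_le⟩

theorem hasPolynomialMaximalIntersectionGrowth_of_isNilpotent_commutator {G : Type*} [Group G]
    [TopologicalSpace G] [IsTopologicalGroup G] [CompactSpace G] (hfg : IsTopologicallyFG G)
    (hnil : ∀ N : OpenNormalSubgroup G, Group.IsNilpotent (commutator (G ⧸ N.toSubgroup))) :
    HasPolynomialMaximalIntersectionGrowth G := by
  obtain ⟨s, hs⟩ := hfg
  let x : Fin s.card → G := fun i => s.equivFin.symm i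
  have hx : (Subgroup.closure (Set.range x)).topologicalClosure = ⊤ := by
    rw [← hs]
    congr 2
    ext g
    exact ⟨fun ⟨i, hi⟩ => hi ▸ (s.equivFin.symm i).2, fun hg => ⟨s.equivFin ⟨g, hg⟩, by simp [x]⟩⟩
  refine ⟨coatomIntersectionExponent s.card, fun n hn => ?_⟩
  by_contra! hlt
  -- The family is not yet known to be finite, so a finite subfamily with exactly one member too
  -- many is extracted; it embeds in a single finite quotient.
  obtain ⟨Y, hYX, hY⟩ := Set.exists_subset_encard_eq (Order.add_one_le_of_lt hlt)
  have hYc : Y.encard = ((n ^ coatomIntersectionExponent s.card + 1 : ℕ) : ℕ∞) := by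
    rw [hY]; push_cast; rfl
  have hYfin : Y.Finite := Set.finite_of_encard_eq_coe hYc
  obtain ⟨N, hN⟩ := exists_openNormalSubgroup_le hYfin fun H hH =>
    ⟨(hYX hH).1, by rw [(hYX hH).2.1]; omega⟩
  have : Finite (G ⧸ N.toSubgroup) := Subgroup.quotient_finite_of_isOpen _ N.isOpen'
  have hsurj := QuotientGroup.mk'_surjective N.toSubgroup
  have hker : ∀ H ∈ Y, (QuotientGroup.mk' N.toSubgroup).ker ≤ H := fun H hH =>
    (QuotientGroup.ker_mk' _).trans_le (hN H hH)
  have h1 : Y.ncard ≤ n ^ coatomIntersectionExponent s.card := by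
    refine (Set.ncard_le_ncard_of_injOn (Subgroup.map (QuotientGroup.mk' N.toSubgroup)) ?_
      ((map_injOn_ker_le _).mono hker) (Set.toFinite _)).trans
      (ncard_coatomIntersections_le_of_isNilpotent (closure_range_quotient_eq_top hx N) (hnil N)
        (by omega))
    intro H hH
    obtain ⟨-, hHn, S, hS, rfl⟩ := hYX hH
    rw [← hHn]
    exact map_mem_coatomIntersections hsurj (fun M hM => (hS M hM).2)
      fun M hM => (hker _ hH).trans (sInf_le hM)
  rw [Set.ncard_def, hYc, ENat.toNat_natCast] at h1
  omega

/-- The derived subgroup of G/N lies in the image of D, the closed derived subgroup, and that image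
is the nilpotent group D/(D ∩ N). -/
theorem IsPronilpotent.isNilpotent_commutator_quotient {G : Type*} [Group G] [TopologicalSpace G]
    [IsTopologicalGroup G] (h : IsPronilpotent (closedDerivedSubgroup G))
    (N : OpenNormalSubgroup G) : Group.IsNilpotent (commutator (G ⧸ N.toSubgroup)) := by
  let D := closedDerivedSubgroup G
  let φ := QuotientGroup.mk' N.toSubgroup
  let f : D →* G ⧸ N.toSubgroup := φ.comp D.subtype
  have hker : f.ker = N.toSubgroup.subgroupOf D := by
    rw [← MonoidHom.comap_ker, QuotientGroup.ker_mk']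
    rfl
  let U : OpenNormalSubgroup D :=
    ⟨⟨f.ker, by rw [hker]; exact N.isOpen'.preimage continuous_subtype_val⟩, f.normal_ker⟩
  have hU : Group.IsNilpotent (D ⧸ f.ker) := h.isNilpotent_quotient U
  have hrange : Group.IsNilpotent f.range :=
    Group.nilpotent_of_mulEquiv (QuotientGroup.quotientKerEquivRange f)
  have hle : commutator (G ⧸ N.toSubgroup) ≤ f.range := by
    rw [← map_commutator_of_surjective (QuotientGroup.mk'_surjective N.toSubgroup)]
    rintro _ ⟨g, hg, rfl⟩
    exact ⟨⟨g, (commutator G).le_topologicalClosure hg⟩, rfl⟩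
  exact Group.nilpotent_of_mulEquiv (Subgroup.subgroupOfEquivOfLe hle)

theorem mainTheorem5 (G : Type*) [Group G] [TopologicalSpace G] [IsTopologicalGroup G]
    (hfg : IsTopologicallyFG G) :
    (IsProsolvable G → IsPronilpotent (closedDerivedSubgroup G) →
      HasPolynomialMaximalIntersectionGrowth G) ∧
    (IsProsupersolvable G → HasPolynomialMaximalIntersectionGrowth G) := by
  refine ⟨fun hG hD => ?_, fun hG => ?_⟩
  · have := hG.compactSpace
    exact hasPolynomialMaximalIntersectionGrowth_of_isNilpotent_commutator hfg
      hD.isNilpotent_commutator_quotient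
  · have := hG.compactSpace
    exact hasPolynomialMaximalIntersectionGrowth_of_isNilpotent_commutator hfg
      fun N => (hG.isSupersolvable_quotient N).isNilpotent_commutator
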